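/- Let $f:\mathbb{C}\to\mathbb{C}$ be a transcendental entire function. Its set of singular values $\operatorname{SV}(f)\subset\mathbb{C}$ is the closure in $\mathbb{C}$ of the set of all critical values and all finite asymptotic values of $f$, where $a\in\mathbb{C}$ is an asymptotic value if there is a path $\gamma:[0,1)\to\mathbb{C}$ with $\gamma(t)\to\infty$ and $f(\gamma(t))\to a$ as $t\to1$. Assume that $f$ is of finite type, i.e. that $\operatorname{SV}(f)$ is finite. For an open set $D\supset\operatorname{SV}(f)$ and $\alpha,\rho>0$ put $$I_\alpha(\rho,D):=\frac1{2\pi}\iint_{\{z:\ |z|\ge\alpha\rho,\ |f(z)|\le\rho,\ f(z)\notin D\}}\frac{dx\,dy}{|z|^2}\in[0,\infty].$$ We say that $f$ has the asymptotic area property (AAP) relative to $D$ if $\limsup_{\rho\to\infty}I_1(\rho,D)<\infty$. **Proposition.** Let $f$ be a transcendental entire function of finite type such that the local degrees of $f$ at its critical points are uniformly bounded. For every $v\in\operatorname{SV}(f)$ let $D_v\ni v$ be a bounded simply connected domain, let the closures $\overline{D_v}$, $v\in\operatorname{SV}(f)$, be pairwise disjoint, and let $D=\bigcup_{v\in\operatorname{SV}(f)}D_v$.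 Suppose that $f$ has AAP relative to $D$. Then for every open set $D'$ with $\operatorname{SV}(f)\subset D'\subset D$: 1. $f$ has AAP relative to $D'$; 2. there are constants $M>1$ and $0<\alpha<1$ (which may depend on $f$, $D$ and $D'$) such that $I_1(\rho,D')<M\,I_\alpha(\rho,D)$ for all sufficiently large $\rho$. -/

import Mathlib

open Set Filter Topology MeasureTheory
open scoped ENNReal

noncomputable section

namespace EntireAAP

/-- A transcendental entire function: holomorphic on the whole plane and not a polynomial. -/
def IsTranscendentalEntire (f : ℂ → ℂ) : Prop :=
  Differentiable ℂ f ∧ ¬ ∃ p : Polynomial ℂ, ∀ z, f z = p.eval z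

/-- The set of critical points of `f`. -/
def criticalPoints (f : ℂ → ℂ) : Set ℂ := {z | deriv f z = 0}

/-- The point `a` of the plane is a (finite) asymptotic value of `f`: there is a path
`γ : [0, 1) → ℂ` which tends to infinity and along which `f` tends to `a`. -/
def IsAsymptoticValue (f : ℂ → ℂ) (a : ℂ) : Prop :=
  ∃ γ : ℝ → ℂ, ContinuousOn γ (Ico 0 1) ∧
    Tendsto γ (𝓝[<] 1) (Bornology.cobounded ℂ) ∧ Tendsto (fun t => f (γ t)) (𝓝[<] 1) (𝓝 a)

/-- The set `SV(f)` of finite singular values: the closure in `ℂ` of the set of critical values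
and finite asymptotic values. -/
def SV (f : ℂ → ℂ) : Set ℂ :=
  closure (f '' criticalPoints f ∪ {a | IsAsymptoticValue f a})

/-- Entire functions of finite type (Speiser class): transcendental entire functions with
finitely many singular values. -/
def IsFiniteType (f : ℂ → ℂ) : Prop :=
  IsTranscendentalEntire f ∧ (SV f).Finite

/-- The local degree of `f` at `z`: the order of vanishing of `w ↦ f w - f z` at `z`. -/
def localDegree (f : ℂ → ℂ) (z : ℂ) : ℕ∞ :=
  analyticOrderAt (fun w => f w - f z) z

/-- The local degrees of `f` at its critical points are uniformly bounded. -/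
def HasBoundedCriticalDegrees (f : ℂ → ℂ) : Prop :=
  ∃ N : ℕ, ∀ c ∈ criticalPoints f, localDegree f c ≤ N

/-- A bounded Riemann domain: a bounded simply connected domain of the plane. -/
def IsBoundedRiemannDomain (U : Set ℂ) : Prop :=
  IsOpen U ∧ IsSimplyConnected U ∧ Bornology.IsBounded U

/-- The cylindrical measure `(1 / 2π) ∬_A dx dy / |z|²` of a set `A` in the plane. -/
def cylindricalMeasure (A : Set ℂ) : ℝ≥0∞ :=
  ENNReal.ofReal (1 / (2 * Real.pi)) * ∫⁻ z in A, ENNReal.ofReal (1 / ‖z‖ ^ 2)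

/-- `I_α(ρ, D)`: the cylindrical measure of
`{z | α ρ ≤ |z|} ∩ f⁻¹(closed disk of radius ρ around 0, minus D)`. -/
def areaIntegral (f : ℂ → ℂ) (α ρ : ℝ) (D : Set ℂ) : ℝ≥0∞ :=
  cylindricalMeasure ({z | α * ρ ≤ ‖z‖} ∩ f ⁻¹' (Metric.closedBall 0 ρ \ D))

/-- The asymptotic area property of `f` relative to `D` (used for `D` open with `SV f ⊆ D`). -/
def HasAAPRelativeTo (f : ℂ → ℂ) (D : Set ℂ) : Prop :=
  limsup (fun ρ : ℝ => areaIntegral f 1 ρ D) atTop < ⊤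

end EntireAAP

end

namespace EntireAAP

/-! Passing from `D` to `D'` only adds preimages of `K = closure D \ D'`, a compact set free of
singular values. It suffices to bound the cylindrical area of the preimage of `K` in `|z| ≥ ρ` by a
constant times that of a fixed disk `N` outside `D`, in `|z| ≥ αρ`. For large `ρ` the latter is at
most `I_1(αρ, D)`, which is bounded by AAP, and also at most `I_α(ρ, D)`.

Over a disk without singular values the preimage splits into univalent inverse branches
(`exists_branch`). At most one branch takes the value `0`, and far out it plays no role. For the
others a weak Koebe theorem (`IsBranchOmittingZero.exists_radius`) gives bounded distortion and
nearly constant modulus on a smaller disk, uniformly in the branch. Summing over branches compares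
the far preimages of nearby small disks (`exists_cylMeasure_farPreimage_ball_le`). The complement of
the finite set `SV f` is connected, so the comparisons chain from `N` to every nonsingular point
(`exists_farDominated`), and compactness covers `K`. The strict inequality also uses that `I_α(ρ, D)
> 0`, by density of values near infinity. -/

/-! ### Density of the values near infinity. -/

/-- An entire function of polynomial growth is a polynomial. -/
theorem exists_polynomial_of_norm_le {f : ℂ → ℂ} (hf : Differentiable ℂ f) {n : ℕ} {C R : ℝ}
    (h : ∀ z, R ≤ ‖z‖ → ‖f z‖ ≤ C * ‖z‖ ^ n) : ∃ p : Polynomial ℂ, ∀ z, f z = p.eval z := by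
  have hvan : ∀ m, n < m → iteratedDeriv m f 0 = 0 := by
    intro m hm
    have hle : ∀ᶠ r : ℝ in atTop, ‖iteratedDeriv m f 0‖ ≤ (m.factorial * C) * r⁻¹ ^ (m - n) := by
      filter_upwards [eventually_ge_atTop R, eventually_gt_atTop 0] with r hr hr0
      have := Complex.norm_iteratedDeriv_le_of_forall_mem_sphere_norm_le (c := 0) (C := C * r ^ n) m
        hr0 hf.diffContOnCl (fun z hz => by
          have hz' : ‖z‖ = r := by simpa using hz
          simpa [hz'] using h z (hz'.symm ▸ hr))
      refine this.trans (le_of_eq ?_)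
      obtain ⟨k, rfl⟩ := Nat.exists_eq_add_of_lt hm
      have : n + k + 1 - n = k + 1 := by omega
      rw [this, inv_pow]
      field_simp
      ring
    have hlim : Tendsto (fun r : ℝ => (m.factorial * C) * r⁻¹ ^ (m - n)) atTop (𝓝 0) := by
      have := (tendsto_inv_atTop_zero (𝕜 := ℝ)).pow (m - n)
      rw [zero_pow (by omega)] at this
      simpa using this.const_mul (m.factorial * C)
    exact norm_le_zero_iff.1 (ge_of_tendsto hlim hle)
  refine ⟨∑ k ∈ Finset.range (n + 1),
    Polynomial.C ((k.factorial : ℂ)⁻¹ * iteratedDeriv k f 0) * Polynomial.X ^ k, fun z => ?_⟩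
  have hs := Complex.hasSum_taylorSeries_of_entire hf 0 z
  rw [← hs.tsum_eq, tsum_eq_sum (s := Finset.range (n + 1)), Polynomial.eval_finsetSum]
  · refine Finset.sum_congr rfl fun k _ => ?_
    simp
    ring
  · intro k hk
    rw [hvan k (by simpa using hk)]
    simp

/-- The values of a transcendental entire function near infinity are dense in the plane. -/
theorem IsTranscendentalEntire.exists_norm_gt_dist_lt {f : ℂ → ℂ} (hf : IsTranscendentalEntire f)
    (w : ℂ) {ε : ℝ} (hε : 0 < ε) (R : ℝ) : ∃ z, R < ‖z‖ ∧ dist (f z) w < ε := by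
  by_contra! H
  refine hf.2 ?_
  -- If `f` stays away from `w` near infinity, `q` is bounded near `0`, so its singularity there is
  -- removable. Then `f z⁻¹` is meromorphic at `0` and `f` has polynomial growth.
  set q : ℂ → ℂ := fun z => (f z⁻¹ - w)⁻¹ with hq
  set r : ℝ := (|R| + 1)⁻¹ with hr
  have hr0 : 0 < r := by positivity
  have hbig : ∀ z ∈ Metric.ball (0 : ℂ) r \ {0}, ε ≤ ‖f z⁻¹ - w‖ := by
    rintro z ⟨hz, hz0⟩
    rw [← dist_eq_norm]
    refine H _ ?_
    have hz0' : 0 < ‖z‖ := norm_pos_iff.2 hz0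
    have : ‖z‖ < r := by simpa using hz
    have h2 : |R| + 1 < ‖z‖⁻¹ := by
      rw [hr] at this
      exact (lt_inv_comm₀ (by positivity) hz0').2 this
    rw [norm_inv]
    linarith [le_abs_self R]
  have hd : DifferentiableOn ℂ q (Metric.ball 0 r \ {0}) := by
    intro z hz
    have h0 : f z⁻¹ - w ≠ 0 := norm_pos_iff.1 (hε.trans_le (hbig z hz))
    have : DifferentiableAt ℂ (fun z : ℂ => f z⁻¹ - w) z :=
      ((hf.1 z⁻¹).comp z (differentiableAt_inv hz.2)).sub_const w
    exact (this.inv h0).differentiableWithinAt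
  have hU : Metric.ball (0 : ℂ) r ∈ 𝓝 0 := Metric.ball_mem_nhds _ hr0
  have hext := Complex.differentiableOn_update_limUnder_of_bddAbove hU hd ⟨ε⁻¹, by
    rintro _ ⟨z, hz, rfl⟩
    simp only [Function.comp, hq, norm_inv]
    exact inv_anti₀ hε (hbig z hz)⟩
  have hmer : MeromorphicAt (fun z => f z⁻¹) 0 := by
    have h1 : MeromorphicAt (fun z => (Function.update q 0 (limUnder (𝓝[≠] 0) q) z)⁻¹ + w) 0 :=
      (hext.analyticAt hU).meromorphicAt.inv.add (MeromorphicAt.const w 0)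
    refine h1.congr ?_
    filter_upwards [self_mem_nhdsWithin] with z hz
    simp [Function.update_of_ne (show z ≠ 0 from hz), hq]
  obtain ⟨n, hn⟩ := hmer
  obtain ⟨C, hC⟩ : ∃ C, ∀ᶠ z : ℂ in 𝓝 0, ‖(z - 0) ^ n • f z⁻¹‖ ≤ C :=
    hn.continuousAt.norm.isBoundedUnder_le
  obtain ⟨δ, hδ, hball⟩ := Metric.eventually_nhds_iff.1 hC
  refine exists_polynomial_of_norm_le hf.1 (n := n) (C := C) (R := 2 * δ⁻¹) fun z hz => ?_
  have hz0 : 0 < ‖z‖ := lt_of_lt_of_le (by positivity) hz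
  have h1 := @hball z⁻¹ (by
    rw [dist_zero_right, norm_inv]
    refine (inv_lt_comm₀ hz0 hδ).2 (lt_of_lt_of_le ?_ hz)
    have := inv_pos.2 hδ
    linarith)
  simp only [sub_zero, inv_inv, smul_eq_mul, norm_mul, norm_pow, norm_inv] at h1
  rw [inv_pow, inv_mul_le_iff₀ (by positivity)] at h1
  linarith

/-! ### Path lifting and inverse branches over nonsingular disks. -/

theorem isLocalHomeomorph_of_deriv_ne_zero {f : ℂ → ℂ} (hf : Differentiable ℂ f) :
    IsLocalHomeomorph (fun z : {z : ℂ // deriv f z ≠ 0} => f z) := by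
  have hopen : IsOpen {z : ℂ | deriv f z ≠ 0} :=
    isOpen_ne_fun (hf.contDiff (n := 1)).continuous_deriv_one continuous_const
  have h1 : IsLocalHomeomorph (Subtype.val : {z : ℂ // deriv f z ≠ 0} → ℂ) :=
    (IsOpen.isOpenEmbedding_subtypeVal hopen).isLocalHomeomorph
  have h2 : IsLocalHomeomorphOn f {z : ℂ | deriv f z ≠ 0} := by
    refine IsLocalHomeomorphOn.mk _ _ fun z hz => ?_
    have hs : HasStrictDerivAt f (deriv f z) z := (hf.contDiff (n := 1)).contDiffAt.hasStrictDerivAt one_ne_zero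
    refine ⟨(hs.hasStrictFDerivAt_equiv hz).toOpenPartialHomeomorph f, ?_, fun _ _ => rfl⟩
    exact HasStrictFDerivAt.mem_toOpenPartialHomeomorph_source _
  rw [isLocalHomeomorph_iff_isLocalHomeomorphOn_univ]
  exact h2.comp h1.isLocalHomeomorphOn (fun z _ => z.2)

/-- Two lifts through `f`, avoiding critical points, which agree at a point of a preconnected set
agree on the set. -/
theorem eqOn_of_lift {A : Type*} [TopologicalSpace A] {f : ℂ → ℂ} (hf : Differentiable ℂ f)
    {s : Set A} (hs : IsPreconnected s) {g₁ g₂ : A → ℂ} (h₁ : ContinuousOn g₁ s)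
    (h₂ : ContinuousOn g₂ s) (he : ∀ x ∈ s, f (g₁ x) = f (g₂ x))
    (hd₁ : ∀ x ∈ s, deriv f (g₁ x) ≠ 0) (hd₂ : ∀ x ∈ s, deriv f (g₂ x) ≠ 0)
    {a : A} (ha : a ∈ s) (hag : g₁ a = g₂ a) : EqOn g₁ g₂ s := by
  have := isPreconnected_iff_preconnectedSpace.1 hs
  let G₁ : s → {z : ℂ // deriv f z ≠ 0} := fun x => ⟨g₁ x, hd₁ x x.2⟩
  let G₂ : s → {z : ℂ // deriv f z ≠ 0} := fun x => ⟨g₂ x, hd₂ x x.2⟩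
  have key : G₁ = G₂ :=
    (T2Space.isSeparatedMap (fun z : {z : ℂ // deriv f z ≠ 0} => f z)).eq_of_comp_eq
      (isLocalHomeomorph_of_deriv_ne_zero hf).isLocallyInjective
      (Continuous.subtype_mk (continuousOn_iff_continuous_domRestrict.1 h₁) _)
      (Continuous.subtype_mk (continuousOn_iff_continuous_domRestrict.1 h₂) _)
      (funext fun x => he x x.2) ⟨a, ha⟩ (Subtype.ext hag)
  intro x hx
  exact congrArg Subtype.val (congrFun key ⟨x, hx⟩)

theorem deriv_ne_zero_of_notMem_SV {f : ℂ → ℂ} {z : ℂ} (h : f z ∉ SV f) : deriv f z ≠ 0 :=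
  fun h0 => h (subset_closure (Or.inl ⟨z, h0, rfl⟩))

/-- `f` is a local homeomorphism at a noncritical point. -/
theorem exists_openPartialHomeomorph {f : ℂ → ℂ} (hf : Differentiable ℂ f) {z : ℂ}
    (hz : deriv f z ≠ 0) : ∃ e : OpenPartialHomeomorph ℂ ℂ, z ∈ e.source ∧ ∀ x, e x = f x := by
  have hs : HasStrictDerivAt f (deriv f z) z :=
    (hf.contDiff (n := 1)).contDiffAt.hasStrictDerivAt one_ne_zero
  exact ⟨(hs.hasStrictFDerivAt_equiv hz).toOpenPartialHomeomorph f,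
    HasStrictFDerivAt.mem_toOpenPartialHomeomorph_source _, fun _ => rfl⟩

/-- A lift of a path on `[0, T)` ending at a nonsingular value converges at `T`. -/
theorem exists_tendsto_of_lift {f : ℂ → ℂ} (hf : Differentiable ℂ f) {γ g : ℝ → ℂ} {T : ℝ}
    (hT : 0 < T) (hγ : Continuous γ) (hg : ContinuousOn g (Ico 0 T))
    (hlift : ∀ t ∈ Ico 0 T, f (g t) = γ t) (hSV : γ T ∉ SV f) :
    ∃ z, f z = γ T ∧ Tendsto g (𝓝[<] T) (𝓝 z) := by
  have hIco : Ico 0 T ∈ 𝓝[<] T := Ico_mem_nhdsLT hT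
  have hfg : Tendsto (fun t => f (g t)) (𝓝[<] T) (𝓝 (γ T)) := by
    refine (hγ.continuousAt.tendsto.mono_left nhdsWithin_le_nhds).congr' ?_
    filter_upwards [hIco] with t ht using (hlift t ht).symm
  -- A lift escaping to infinity would, rescaled to `[0, 1)`, exhibit `γ T` as an asymptotic value.
  have hnot : ¬ Tendsto g (𝓝[<] T) (Bornology.cobounded ℂ) := by
    intro hinf
    have hscale : Tendsto (fun t : ℝ => T * t) (𝓝[<] 1) (𝓝[<] T) := by
      refine tendsto_nhdsWithin_iff.2 ⟨?_, ?_⟩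
      · have : Tendsto (fun t : ℝ => T * t) (𝓝 1) (𝓝 (T * 1)) := tendsto_id.const_mul T
        rw [mul_one] at this
        exact this.mono_left nhdsWithin_le_nhds
      · filter_upwards [self_mem_nhdsWithin] with t ht
        exact (mul_lt_iff_lt_one_right hT).2 ht
    refine hSV (subset_closure (Or.inr ⟨fun t => g (T * t), ?_, hinf.comp hscale,
      hfg.comp hscale⟩))
    refine hg.comp (by fun_prop) fun t ht => ⟨mul_nonneg hT.le ht.1, ?_⟩
    exact (mul_lt_iff_lt_one_right hT).2 ht.2
  obtain ⟨R, hR⟩ : ∃ R : ℝ, ∃ᶠ t in 𝓝[<] T, g t ∈ Metric.closedBall (0 : ℂ) R := by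
    by_contra! H
    refine hnot (tendsto_norm_atTop_iff_cobounded.1 (tendsto_atTop.2 fun R => ?_))
    filter_upwards [H R] with t ht
    have : R < ‖g t‖ := by simpa using ht
    exact this.le
  obtain ⟨z, -, hz⟩ := (isCompact_closedBall (0 : ℂ) R).exists_mapClusterPt_of_frequently hR
  have hfz : f z = γ T := by
    have h1 : MapClusterPt (f z) (𝓝[<] T) (fun t => f (g t)) :=
      hz.continuousAt_comp hf.continuous.continuousAt
    have h2 : ClusterPt (f z) (𝓝 (γ T)) := ClusterPt.mono h1 hfg
    exact @eq_of_nhds_neBot _ _ _ _ _ h2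
  refine ⟨z, hfz, ?_⟩
  obtain ⟨e, hze, he⟩ := exists_openPartialHomeomorph hf
    (deriv_ne_zero_of_notMem_SV (f := f) (z := z) (hfz ▸ hSV))
  obtain ⟨r₀, hr₀, hball⟩ := Metric.isOpen_iff.1 e.open_source z hze
  rw [Metric.tendsto_nhds]
  intro ε hε
  set r := min (r₀ / 2) (ε / 2) with hr
  have hrpos : 0 < r := by positivity
  have hrε : r < ε := (min_le_right _ _).trans_lt (by linarith)
  have hrr : r < r₀ := (min_le_left _ _).trans_lt (by linarith)
  -- Near `T` the path avoids the compact image of this small circle, so the lift cannot cross the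
  -- circle. Since it keeps returning to the inside, it stays there.
  have hsph : γ T ∉ f '' Metric.sphere z r := by
    rintro ⟨x, hx, hfx⟩
    have hxs : x ∈ e.source := hball (by
      rw [Metric.mem_ball, Metric.mem_sphere.1 hx]; exact hrr)
    have : x = z := e.injOn hxs hze (by rw [he, he, hfx, hfz])
    subst this
    simp at hx
    linarith
  have hclosed : IsClosed (f '' Metric.sphere z r) :=
    ((isCompact_sphere z r).image hf.continuous).isClosed
  have hev : ∀ᶠ t in 𝓝[<] T, dist (g t) z ≠ r := by
    filter_upwards [hfg (hclosed.isOpen_compl.mem_nhds hsph)] with t ht h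
    exact ht ⟨g t, h, rfl⟩
  obtain ⟨a, haT, ha⟩ := (mem_nhdsLT_iff_exists_Ioo_subset).1 (hev.and hIco)
  obtain ⟨t₁, ht₁, hgt₁⟩ : ∃ t ∈ Ioo a T, dist (g t) z < r := by
    have := hz.frequently (Metric.ball_mem_nhds z hrpos)
    obtain ⟨t, h1, h2⟩ := (this.and_eventually (Ioo_mem_nhdsLT haT)).exists
    exact ⟨t, h2, h1⟩
  filter_upwards [Ioo_mem_nhdsLT haT] with t ht
  by_contra! hge
  have hcont : ContinuousOn (fun t => dist (g t) z) (Ioo a T) :=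
    (continuous_id.dist continuous_const).comp_continuousOn (hg.mono fun x hx => (ha hx).2)
  obtain ⟨x, hx, hxr⟩ := isPreconnected_Ioo.intermediate_value ht₁ ht hcont
    ⟨hgt₁.le, hrε.le.trans hge⟩
  exact (ha hx).1 hxr

/-- `T` is a time up to which the path `γ` has a lift through `f` starting at `z₀`. -/
def HasLiftUpTo (f : ℂ → ℂ) (γ : ℝ → ℂ) (z₀ : ℂ) (T : ℝ) : Prop :=
  ∃ g : ℝ → ℂ, ContinuousOn g (Icc 0 T) ∧ g 0 = z₀ ∧ ∀ t ∈ Icc 0 T, f (g t) = γ t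

/-- The lift is continued by the local inverse of `f` at its endpoint. All intermediate times are
included so that the extension can be truncated at time `1`. -/
theorem HasLiftUpTo.exists_gt {f : ℂ → ℂ} (hf : Differentiable ℂ f) {γ : ℝ → ℂ} {z₀ : ℂ} {T : ℝ}
    (hT : 0 ≤ T) (hγ : Continuous γ) (hSV : γ T ∉ SV f) (h : HasLiftUpTo f γ z₀ T) :
    ∃ T' > T, ∀ S ∈ Icc T T', HasLiftUpTo f γ z₀ S := by
  obtain ⟨g, hg, hg0, hlift⟩ := h
  have hTT : f (g T) = γ T := hlift T ⟨hT, le_rfl⟩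
  obtain ⟨e, hze, he⟩ := exists_openPartialHomeomorph hf
    (deriv_ne_zero_of_notMem_SV (f := f) (z := g T) (hTT ▸ hSV))
  have hmem : γ ⁻¹' e.target ∈ 𝓝 T :=
    hγ.continuousAt.preimage_mem_nhds (e.open_target.mem_nhds (by
      rw [← hTT, ← he]; exact e.map_source hze))
  obtain ⟨ε, hε, hball⟩ := Metric.mem_nhds_iff.1 hmem
  refine ⟨T + ε / 2, by linarith, fun S hS => ?_⟩
  have htar : ∀ t ∈ Icc T S, γ t ∈ e.target := fun t ht => hball (by
    rw [Metric.mem_ball, Real.dist_eq, abs_of_nonneg (by linarith [ht.1])]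
    linarith [ht.2, hS.2])
  refine ⟨fun t => if t ≤ T then g t else e.symm (γ t), ?_, by simp [hT, hg0], ?_⟩
  · refine ContinuousOn.if ?_ ?_ ?_
    · rintro t ⟨ht, hfr⟩
      have : t = T := by
        have := frontier_le_subset_eq continuous_id continuous_const hfr
        simpa using this
      subst this
      rw [← hTT, ← he, e.left_inv hze]
    · refine hg.mono ?_
      rintro t ⟨ht, hcl⟩
      exact ⟨ht.1, closure_minimal (fun x (hx : x ≤ T) => hx) isClosed_Iic hcl⟩
    · refine e.continuousOn_symm.comp hγ.continuousOn ?_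
      rintro t ⟨ht, hcl⟩
      have : t ∈ Ici T :=
        closure_minimal (fun x (hx : ¬ x ≤ T) => (not_le.1 hx).le) isClosed_Ici hcl
      exact htar t ⟨this, ht.2⟩
  · intro t ht
    by_cases h : t ≤ T
    · simp only [h, if_true]
      exact hlift t ⟨ht.1, h⟩
    · simp only [h, if_false]
      rw [← he]
      exact e.right_inv (htar t ⟨(not_le.1 h).le, ht.2⟩)

/-- Paths in the complement of the singular set lift through `f`. -/
theorem hasLiftUpTo_one {f : ℂ → ℂ} (hf : Differentiable ℂ f) {γ : ℝ → ℂ} (hγ : Continuous γ)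
    (hSV : ∀ t ∈ Icc (0 : ℝ) 1, γ t ∉ SV f) {z₀ : ℂ} (hz₀ : f z₀ = γ 0) :
    HasLiftUpTo f γ z₀ 1 := by
  set S : Set ℝ := {T | T ∈ Icc (0 : ℝ) 1 ∧ HasLiftUpTo f γ z₀ T} with hS
  have h0S : (0 : ℝ) ∈ S := by
    refine ⟨⟨le_rfl, zero_le_one⟩, fun _ => z₀, continuousOn_const, rfl, fun t ht => ?_⟩
    have : t = 0 := le_antisymm ht.2 ht.1
    rw [this, hz₀]
  have hbdd : BddAbove S := ⟨1, fun T hT => hT.1.2⟩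
  set T := sSup S with hT
  have hT0 : 0 ≤ T := le_csSup hbdd h0S
  have hT1 : T ≤ 1 := csSup_le ⟨0, h0S⟩ fun x hx => hx.1.2
  have hTS : HasLiftUpTo f γ z₀ T := by
    rcases hT0.eq_or_lt with h | hTpos
    · rw [← h]; exact h0S.2
    have hlt : ∀ t ∈ Ico 0 T, HasLiftUpTo f γ z₀ t := by
      intro t ht
      obtain ⟨x, hx, htx⟩ := exists_lt_of_lt_csSup ⟨0, h0S⟩ ht.2
      obtain ⟨-, g, hg, hg0, hl⟩ := hx
      exact ⟨g, hg.mono (Icc_subset_Icc_right htx.le), hg0, fun s hs => hl s ⟨hs.1, hs.2.trans htx.le⟩⟩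
    choose! G hG hG0 hGl using hlt
    have hagree : ∀ s ∈ Ico 0 T, ∀ t ∈ Icc 0 s, G t t = G s t := by
      intro s hs t ht
      have htT : t ∈ Ico 0 T := ⟨ht.1, ht.2.trans_lt hs.2⟩
      have hsub : Icc 0 t ⊆ Icc 0 s := Icc_subset_Icc_right ht.2
      refine eqOn_of_lift hf (isPreconnected_Icc (a := 0) (b := t)) (hG t htT) ((hG s hs).mono hsub)
        (fun x hx => ?_) (fun x hx => ?_) (fun x hx => ?_) (a := 0) ⟨le_rfl, ht.1⟩ ?_ ⟨ht.1, le_rfl⟩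
      · rw [hGl t htT x hx, hGl s hs x (hsub hx)]
      · exact deriv_ne_zero_of_notMem_SV (by
          rw [hGl t htT x hx]; exact hSV x ⟨hx.1, by linarith [hx.2, htT.2]⟩)
      · exact deriv_ne_zero_of_notMem_SV (by
          rw [hGl s hs x (hsub hx)]; exact hSV x ⟨hx.1, by linarith [hx.2, htT.2]⟩)
      · rw [hG0 t htT, hG0 s hs]
    -- By uniqueness the partial lifts agree, so the diagonal glues them into one lift on `[0, T)`.
    set g : ℝ → ℂ := fun t => G t t with hg
    have hgc : ContinuousOn g (Ico 0 T) := by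
      intro t ht
      obtain ⟨s, hts, hsT⟩ := exists_between ht.2
      have hs : s ∈ Ico 0 T := ⟨ht.1.trans hts.le, hsT⟩
      have h1 : ContinuousOn g (Icc 0 s) := (hG s hs).congr fun x hx => hagree s hs x hx
      refine (h1 t ⟨ht.1, hts.le⟩).mono_of_mem_nhdsWithin ?_
      filter_upwards [self_mem_nhdsWithin, nhdsWithin_le_nhds (Iio_mem_nhds hts)] with x hx hxs
      exact ⟨hx.1, le_of_lt hxs⟩
    have hgl : ∀ t ∈ Ico 0 T, f (g t) = γ t := fun t ht => hGl t ht t ⟨ht.1, le_rfl⟩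
    obtain ⟨z, hfz, hz⟩ := exists_tendsto_of_lift hf hTpos hγ hgc hgl (hSV T ⟨hT0, hT1⟩)
    refine ⟨Function.update g T z, ?_, ?_, ?_⟩
    · rw [continuousOn_update_iff, Icc_sdiff_right]
      exact ⟨hgc, fun _ => hz.mono_left (nhdsWithin_mono _ fun x hx => hx.2)⟩
    · rw [Function.update_of_ne hTpos.ne]
      exact hG0 0 ⟨le_rfl, hTpos⟩
    · intro t ht
      rcases ht.2.eq_or_lt with rfl | h
      · simpa using hfz
      · rw [Function.update_of_ne h.ne]
        exact hgl t ⟨ht.1, h⟩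
  rcases hT1.eq_or_lt with h | hlt
  · rwa [← h]
  · exfalso
    obtain ⟨T', hT', hl⟩ := hTS.exists_gt hf hT0 hγ (hSV T ⟨hT0, hT1⟩)
    have hmem : min T' 1 ∈ S :=
      ⟨⟨le_min (hT0.trans hT'.le) zero_le_one, min_le_right _ _⟩,
        hl _ ⟨le_min hT'.le hlt.le, min_le_left _ _⟩⟩
    have := le_csSup hbdd hmem
    exact absurd (lt_min hT' hlt) (not_lt.2 this)

/-- Every preimage of a point of a disk without singular values lies on a holomorphic branch of
the inverse function defined on the whole disk. -/
theorem exists_branch {f : ℂ → ℂ} (hf : Differentiable ℂ f) {w : ℂ} {r : ℝ}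
    (hB : ∀ ζ ∈ Metric.ball w r, ζ ∉ SV f) {z₀ : ℂ} (hz₀ : f z₀ ∈ Metric.ball w r) :
    ∃ φ : ℂ → ℂ, DifferentiableOn ℂ φ (Metric.ball w r) ∧
      (∀ ζ ∈ Metric.ball w r, f (φ ζ) = ζ) ∧ φ (f z₀) = z₀ := by
  let B := Metric.ball w r
  let γ : ℂ → ℝ → ℂ := fun a t => f z₀ + t * (a - f z₀)
  have hγB : ∀ a ∈ B, ∀ t ∈ Icc (0 : ℝ) 1, γ a t ∈ B := by
    intro a ha t ht
    have := (convex_ball w r).add_smul_sub_mem hz₀ ha ht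
    simpa [γ, B] using this
  have hl : ∀ a ∈ B, HasLiftUpTo f (γ a) z₀ 1 := fun a ha =>
    hasLiftUpTo_one hf (by fun_prop) (fun t ht => hB _ (hγB a ha t ht)) (by simp [γ])
  choose! G hG hG0 hGl using hl
  have hcrit : ∀ p : unitInterval × B, deriv f (G p.2 p.1) ≠ 0 := fun p =>
    deriv_ne_zero_of_notMem_SV (by
      rw [hGl p.2 p.2.2 p.1 p.1.2]; exact hB _ (hγB _ p.2.2 _ p.1.2))
  let g : unitInterval × B → {z : ℂ // deriv f z ≠ 0} := fun p => ⟨G p.2 p.1, hcrit p⟩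
  let F : C(unitInterval × B, ℂ) := ⟨fun p => γ p.2 p.1, by fun_prop⟩
  -- The lifted segments depend continuously on their endpoint: they are continuous in time and
  -- share the starting point `z₀`, so lifting through a local homeomorphism is jointly continuous.
  have hcont : Continuous g := by
    refine (isLocalHomeomorph_of_deriv_ne_zero hf).continuous_lift (T2Space.isSeparatedMap _) F
      (funext fun p => hGl p.2 p.2.2 p.1 p.1.2) ?_ fun a => ?_
    · refine Continuous.subtype_mk ?_ _
      have : (fun a : B => G a ((0 : unitInterval) : ℝ)) = fun _ => z₀ :=
        funext fun a => hG0 a a.2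
      rw [this]
      exact continuous_const
    · exact Continuous.subtype_mk (continuousOn_iff_continuous_domRestrict.1 (hG a a.2)) _
  have hφc : ContinuousOn (fun a => G a 1) B := by
    rw [continuousOn_iff_continuous_domRestrict]
    exact (continuous_subtype_val.comp hcont).comp (Continuous.prodMk_right (1 : unitInterval))
  have hφl : ∀ ζ ∈ B, f (G ζ 1) = ζ := fun ζ hζ => by
    rw [hGl ζ hζ 1 ⟨zero_le_one, le_rfl⟩]; simp [γ]
  refine ⟨fun a => G a 1, fun ζ hζ => ?_, hφl, ?_⟩
  · refine (HasDerivAt.of_local_left_inverse (hφc.continuousAt (Metric.isOpen_ball.mem_nhds hζ))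
      (hf _).hasDerivAt (deriv_ne_zero_of_notMem_SV ?_) ?_).differentiableAt.differentiableWithinAt
    · rw [hφl ζ hζ]; exact hB ζ hζ
    · filter_upwards [Metric.isOpen_ball.mem_nhds hζ] with x hx using hφl x hx
  · have hconst : EqOn (G (f z₀)) (fun _ => z₀) (Icc 0 1) := by
      have hγc : ∀ t, γ (f z₀) t = f z₀ := fun t => by simp [γ]
      have hd : deriv f z₀ ≠ 0 := deriv_ne_zero_of_notMem_SV (hB _ hz₀)
      refine eqOn_of_lift hf isPreconnected_Icc (hG _ hz₀) continuousOn_const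
        (fun t ht => by rw [hGl _ hz₀ t ht, hγc]) (fun t ht => deriv_ne_zero_of_notMem_SV ?_)
        (fun _ _ => hd) (a := 0) ⟨le_rfl, zero_le_one⟩ (hG0 _ hz₀)
      rw [hGl _ hz₀ t ht, hγc]
      exact hB _ hz₀
    exact hconst ⟨zero_le_one, le_rfl⟩

/-- Two branches of the inverse function on a disk without singular values whose images meet
coincide. -/
theorem branch_eqOn {f : ℂ → ℂ} (hf : Differentiable ℂ f) {w : ℂ} {r : ℝ}
    (hB : ∀ ζ ∈ Metric.ball w r, ζ ∉ SV f) {φ ψ : ℂ → ℂ}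
    (hφ : DifferentiableOn ℂ φ (Metric.ball w r)) (hψ : DifferentiableOn ℂ ψ (Metric.ball w r))
    (hφf : ∀ ζ ∈ Metric.ball w r, f (φ ζ) = ζ) (hψf : ∀ ζ ∈ Metric.ball w r, f (ψ ζ) = ζ)
    {ζ ξ : ℂ} (hζ : ζ ∈ Metric.ball w r) (hξ : ξ ∈ Metric.ball w r) (h : φ ζ = ψ ξ) :
    EqOn φ ψ (Metric.ball w r) := by
  have hζξ : ζ = ξ := by rw [← hφf ζ hζ, h, hψf ξ hξ]
  subst hζξ
  refine eqOn_of_lift hf (convex_ball w r).isPreconnected hφ.continuousOn hψ.continuousOn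
    (fun x hx => by rw [hφf x hx, hψf x hx]) (fun x hx => deriv_ne_zero_of_notMem_SV ?_)
    (fun x hx => deriv_ne_zero_of_notMem_SV ?_) hζ h
  · rw [hφf x hx]; exact hB x hx
  · rw [hψf x hx]; exact hB x hx

/-! ### Weak Koebe theorems by the square root trick. -/

/-- A nowhere vanishing holomorphic function on a disk with value `1` at the center has a
holomorphic square root with value `1` at the center. -/
theorem exists_differentiableOn_sqrt {q : ℂ → ℂ} {w : ℂ} {r : ℝ} (hr : 0 < r)
    (hq : DifferentiableOn ℂ q (Metric.ball w r)) (hq0 : ∀ z ∈ Metric.ball w r, q z ≠ 0)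
    (hqw : q w = 1) :
    ∃ s : ℂ → ℂ, DifferentiableOn ℂ s (Metric.ball w r) ∧ s w = 1 ∧
      ∀ z ∈ Metric.ball w r, s z ^ 2 = q z := by
  have hw : w ∈ Metric.ball w r := Metric.mem_ball_self hr
  obtain ⟨L, hL⟩ := ((hq.deriv Metric.isOpen_ball).div hq hq0).isExactOn_ball
  have hqd : ∀ z ∈ Metric.ball w r, HasDerivAt q (deriv q z) z := fun z hz =>
    (hq.differentiableAt (Metric.isOpen_ball.mem_nhds hz)).hasDerivAt
  set K : ℂ → ℂ := fun z => L z - L w with hK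
  have hKd : ∀ z ∈ Metric.ball w r, HasDerivAt K (deriv q z / q z) z := fun z hz =>
    (hL z hz).sub_const _
  have hconst : ∀ z ∈ Metric.ball w r, q z * Complex.exp (-K z) = 1 := by
    have hd : ∀ z ∈ Metric.ball w r, HasDerivAt (fun z => q z * Complex.exp (-K z)) 0 z := by
      intro z hz
      have := (hqd z hz).mul (hKd z hz).neg.cexp
      convert! this using 1
      field_simp [hq0 z hz]
      ring
    intro z hz
    have := Metric.isOpen_ball.is_const_of_deriv_eq_zero (convex_ball w r).isPreconnected
      (fun z hz => (hd z hz).differentiableAt.differentiableWithinAt)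
      (fun z hz => (hd z hz).deriv) hz hw
    rw [this]
    simp [hK, hqw]
  refine ⟨fun z => Complex.exp (K z / 2), fun z hz => ?_, by simp [hK], fun z hz => ?_⟩
  · exact ((hKd z hz).div_const 2).cexp.differentiableAt.differentiableWithinAt
  · rw [← Complex.exp_nat_mul]
    have h1 := hconst z hz
    rw [Complex.exp_neg] at h1
    have : q z = Complex.exp (K z) := by
      field_simp at h1
      exact h1
    rw [this]
    congr 1
    push_cast
    ring

/-- The standing assumptions on a holomorphic branch `φ` on the disk `ball w r` of the inverse of
the entire function `f`, omitting the value `0`. -/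
structure IsBranchOmittingZero (f φ : ℂ → ℂ) (w : ℂ) (r : ℝ) : Prop where
  entire : Differentiable ℂ f
  pos : 0 < r
  differentiableOn : DifferentiableOn ℂ φ (Metric.ball w r)
  apply_apply : ∀ ζ ∈ Metric.ball w r, f (φ ζ) = ζ
  ne_zero : ∀ ζ ∈ Metric.ball w r, φ ζ ≠ 0

namespace IsBranchOmittingZero

variable {f φ : ℂ → ℂ} {w : ℂ} {r : ℝ}

theorem mono (h : IsBranchOmittingZero f φ w r) {w' : ℂ} {r' : ℝ} (hr' : 0 < r')
    (hsub : Metric.ball w' r' ⊆ Metric.ball w r) : IsBranchOmittingZero f φ w' r' :=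
  ⟨h.entire, hr', h.differentiableOn.mono hsub, fun ζ hζ => h.apply_apply ζ (hsub hζ),
    fun ζ hζ => h.ne_zero ζ (hsub hζ)⟩

theorem deriv_mul_deriv (h : IsBranchOmittingZero f φ w r) {ζ : ℂ} (hζ : ζ ∈ Metric.ball w r) :
    deriv f (φ ζ) * deriv φ ζ = 1 := by
  have hnhds := Metric.isOpen_ball.mem_nhds hζ
  have h1 := (h.entire (φ ζ)).hasDerivAt.comp ζ (h.differentiableOn.differentiableAt hnhds).hasDerivAt
  have h2 : HasDerivAt (f ∘ φ) 1 ζ := (hasDerivAt_id ζ).congr_of_eventuallyEq (by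
    filter_upwards [hnhds] with x hx using h.apply_apply x hx)
  exact h1.unique h2

theorem isOpen_image (h : IsBranchOmittingZero f φ w r) : IsOpen (φ '' Metric.ball w r) := by
  rw [isOpen_iff_mem_nhds]
  rintro _ ⟨ζ, hζ, rfl⟩
  have hnhds := Metric.isOpen_ball.mem_nhds hζ
  have hne : deriv φ ζ ≠ 0 := right_ne_zero_of_mul_eq_one (h.deriv_mul_deriv hζ)
  have hs : HasStrictDerivAt φ (deriv φ ζ) ζ :=
    (h.differentiableOn.analyticAt hnhds).hasStrictDerivAt
  rw [← hs.map_nhds_eq hne]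
  exact image_mem_map hnhds

/-- The nearest omitted value. -/
theorem exists_nearest_omitted (h : IsBranchOmittingZero f φ w r) :
    ∃ a, a ∉ φ '' Metric.ball w r ∧ 0 < ‖a - φ w‖ ∧
      Metric.ball (φ w) ‖a - φ w‖ ⊆ φ '' Metric.ball w r ∧ ‖a - φ w‖ ≤ ‖φ w‖ := by
  have h0 : (0 : ℂ) ∈ (φ '' Metric.ball w r)ᶜ := by
    rintro ⟨ζ, hζ, h0⟩
    exact h.ne_zero ζ hζ h0
  obtain ⟨a, ha, hdist⟩ := h.isOpen_image.isClosed_compl.exists_infDist_eq_dist ⟨0, h0⟩ (φ w)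
  have hle : ∀ y ∈ (φ '' Metric.ball w r)ᶜ, ‖a - φ w‖ ≤ dist (φ w) y := by
    intro y hy
    rw [← dist_eq_norm, dist_comm, ← hdist]
    exact Metric.infDist_le_dist_of_mem hy
  refine ⟨a, ha, ?_, ?_, ?_⟩
  · rw [norm_pos_iff, sub_ne_zero]
    rintro rfl
    exact ha ⟨w, Metric.mem_ball_self h.pos, rfl⟩
  · intro y hy
    by_contra hy'
    have := hle y hy'
    rw [Metric.mem_ball, dist_comm] at hy
    linarith
  · simpa using hle 0 h0

/-- On the open disk `f` inverts `φ`, and continuity passes to the closure. This supplies the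
boundary bound for Cauchy's estimate. -/
theorem mapsTo_closedBall (h : IsBranchOmittingZero f φ w r) {d : ℝ} (hd : 0 < d)
    (hsub : Metric.ball (φ w) d ⊆ φ '' Metric.ball w r) {z : ℂ}
    (hz : z ∈ Metric.closedBall (φ w) d) : f z ∈ Metric.closedBall w r := by
  rw [← closure_ball _ hd.ne'] at hz
  have hm : MapsTo f (Metric.ball (φ w) d) (Metric.ball w r) := by
    intro x hx
    obtain ⟨ζ, hζ, rfl⟩ := hsub hx
    rwa [h.apply_apply ζ hζ]
  have := hm.closure h.entire.continuous hz
  rwa [closure_ball _ h.pos.ne'] at this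

/-- A disk contained in the image has radius at most `r |φ'(w)|`. -/
theorem radius_le (h : IsBranchOmittingZero f φ w r) {d : ℝ} (hd : 0 < d)
    (hsub : Metric.ball (φ w) d ⊆ φ '' Metric.ball w r) : d ≤ r * ‖deriv φ w‖ := by
  have hw : w ∈ Metric.ball w r := Metric.mem_ball_self h.pos
  have h1 := Complex.norm_deriv_le_of_forall_mem_sphere_norm_le (f := fun z => f z - w) (c := φ w)
    (C := r) hd (h.entire.sub_const w).diffContOnCl (fun z hz => by
      have := h.mapsTo_closedBall hd hsub (Metric.sphere_subset_closedBall hz)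
      rwa [mem_closedBall_iff_norm] at this)
  rw [deriv_sub_const] at h1
  have h2 := congrArg norm (h.deriv_mul_deriv hw)
  rw [norm_mul, norm_one] at h2
  have h3 : 0 < ‖deriv φ w‖ := by
    refine lt_of_le_of_ne (norm_nonneg _) fun h0 => ?_
    rw [← h0, mul_zero] at h2
    exact zero_ne_one h2
  rw [le_div_iff₀ hd] at h1
  calc d = ‖deriv f (φ w)‖ * d * ‖deriv φ w‖ := by linear_combination (-d) * h2
    _ ≤ r * ‖deriv φ w‖ := by gcongr

/-- A univalent function on a disk grows in a controlled way near the center. -/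
theorem norm_sub_le (h : IsBranchOmittingZero f φ w r) {a : ℂ} (ha : a ∉ φ '' Metric.ball w r)
    (hd : 0 < ‖a - φ w‖) (hsub : Metric.ball (φ w) ‖a - φ w‖ ⊆ φ '' Metric.ball w r) {ζ : ℂ}
    (hζ : ζ ∈ Metric.ball w (r / 20)) : ‖φ ζ - φ w‖ ≤ 26 * ‖a - φ w‖ := by
  have hr := h.pos
  have hw : w ∈ Metric.ball w r := Metric.mem_ball_self hr
  have hne : a - φ w ≠ 0 := norm_pos_iff.1 hd
  set d := ‖a - φ w‖ with hdef
  obtain ⟨s, hs, hsw, hsq⟩ := exists_differentiableOn_sqrt (q := fun z => (a - φ z) / (a - φ w)) hr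
    ((h.differentiableOn.const_sub a).div_const _)
    (fun z hz => div_ne_zero (sub_ne_zero.2 fun e => ha ⟨z, hz, e.symm⟩) hne) (div_self hne)
  have hs0 : ∀ z ∈ Metric.ball w r, s z ≠ 0 := by
    intro z hz h0
    have := hsq z hz
    rw [h0, zero_pow two_ne_zero, eq_comm, div_eq_zero_iff] at this
    rcases this with h1 | h1
    · exact ha ⟨z, hz, (sub_eq_zero.1 h1).symm⟩
    · exact hne h1
  -- the values of `s` cover a disk around `1`, hence `s` omits a disk around `-1`
  let y : ℂ → ℂ := fun u => φ w + (a - φ w) * (1 - (1 + u) ^ 2)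
  -- The point `y u` solves `(a - y) / (a - φ w) = (1 + u)²`. The radius works because `2·(2/5) +
  -- (2/5)² = 24/25 < 1`.
  have hy : ∀ u ∈ Metric.ball (0 : ℂ) (2 / 5), y u ∈ Metric.ball (φ w) d := by
    intro u hu
    have hu' : ‖u‖ < 2 / 5 := by simpa using hu
    rw [mem_ball_iff_norm]
    have h1 : y u - φ w = (a - φ w) * (-(2 * u + u ^ 2)) := by simp only [y]; ring
    have h2 : ‖2 * u + u ^ 2‖ < 1 := by
      calc ‖2 * u + u ^ 2‖ ≤ ‖2 * u‖ + ‖u ^ 2‖ := norm_add_le _ _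
        _ = 2 * ‖u‖ + ‖u‖ ^ 2 := by simp
        _ < 1 := by nlinarith [norm_nonneg u]
    rw [h1, norm_mul, norm_neg]
    exact mul_lt_of_lt_one_right hd h2
  have hfy : ∀ u ∈ Metric.ball (0 : ℂ) (2 / 5), f (y u) ∈ Metric.ball w r ∧ φ (f (y u)) = y u := by
    intro u hu
    obtain ⟨x, hx, hxy⟩ := hsub (hy u hu)
    rw [← hxy, h.apply_apply x hx]
    exact ⟨hx, rfl⟩
  have hsec : EqOn (fun u => s (f (y u))) (fun u => 1 + u) (Metric.ball (0 : ℂ) (2 / 5)) := by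
    refine (convex_ball (0 : ℂ) (2 / 5)).isPreconnected.eq_of_sq_eq ?_ (by fun_prop) ?_ ?_
      (y := 0) (by simp) ?_
    · refine hs.continuousOn.comp ?_ fun u hu => (hfy u hu).1
      exact (h.entire.continuous.comp (by fun_prop : Continuous y)).continuousOn
    · intro u hu
      simp only [Pi.pow_apply]
      rw [hsq _ (hfy u hu).1, (hfy u hu).2]
      field_simp
      simp only [y]
      ring
    · intro u hu h0
      have hu' : ‖u‖ < 2 / 5 := by simpa using hu
      have : u = -1 := by linear_combination h0
      rw [this] at hu'
      norm_num at hu'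
    · have : f (y 0) = w := by
        have : y 0 = φ w := by simp [y]
        rw [this, h.apply_apply w hw]
      simp [this, hsw]
  -- If `s z = -(1 + u)` with `u` small, then `y u = φ z`, so `hsec` forces `s z = 1 + u = -s z`,
  -- although `s` has no zeros.
  have hlow : ∀ z ∈ Metric.ball w r, 2 / 5 ≤ ‖1 + s z‖ := by
    intro z hz
    by_contra! hlt
    have hu : -(1 + s z) ∈ Metric.ball (0 : ℂ) (2 / 5) := by
      rwa [mem_ball_zero_iff, norm_neg]
    have h1 : y (-(1 + s z)) = φ z := by
      have := hsq z hz
      rw [eq_div_iff hne] at this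
      simp only [y]
      linear_combination -this
    have h2 := hsec hu
    simp only [h1, h.apply_apply z hz] at h2
    exact hs0 z hz (by linear_combination h2 / 2)
  have h1s : ∀ z ∈ Metric.ball w r, 1 + s z ≠ 0 := fun z hz =>
    norm_pos_iff.1 (lt_of_lt_of_le (by norm_num) (hlow z hz))
  -- `T` is bounded by `5/2`, so Cauchy's estimate on radius `r/2` gives `|T'| ≤ 5/r`. Within `r/20`
  -- of the center `T` moves at most `1/4` from `T w = 1/2`; hence `|1 + s| ≤ 4`, `|s| ≤ 5` and `|1
  -- - s²| ≤ 26`.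
  set T : ℂ → ℂ := fun z => (1 + s z)⁻¹ with hT
  have hTd : DifferentiableOn ℂ T (Metric.ball w r) := (hs.const_add 1).inv h1s
  have hTb : ∀ z ∈ Metric.ball w r, ‖T z‖ ≤ 5 / 2 := by
    intro z hz
    rw [hT]
    simp only [norm_inv]
    calc ‖1 + s z‖⁻¹ ≤ (2 / 5 : ℝ)⁻¹ := inv_anti₀ (by norm_num) (hlow z hz)
      _ = 5 / 2 := by norm_num
  have hTder : ∀ z ∈ Metric.ball w (r / 20), ‖deriv T z‖ ≤ 5 / r := by
    intro z hz
    have hcl : Metric.closedBall z (r / 2) ⊆ Metric.ball w r := by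
      refine Metric.closedBall_subset_ball' ?_
      rw [Metric.mem_ball] at hz
      linarith
    have := Complex.norm_deriv_le_of_forall_mem_sphere_norm_le (f := T) (c := z) (C := 5 / 2)
      (half_pos hr) (hTd.mono (closure_ball z (half_pos hr).ne' ▸ hcl)).diffContOnCl
      (fun x hx => hTb x (hcl (Metric.sphere_subset_closedBall hx)))
    refine this.trans (le_of_eq ?_)
    field_simp
  have hsub20 : Metric.ball w (r / 20) ⊆ Metric.ball w r := Metric.ball_subset_ball (by linarith)
  have hTw : T w = 1 / 2 := by rw [hT]; simp only [hsw]; norm_num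
  have hTclose : ‖T ζ - T w‖ ≤ 1 / 4 := by
    have := (convex_ball w (r / 20)).norm_image_sub_le_of_norm_deriv_le (f := T) (C := 5 / r)
      (fun x hx => hTd.differentiableAt (Metric.isOpen_ball.mem_nhds (hsub20 hx))) hTder
      (Metric.mem_ball_self (by positivity)) hζ
    refine this.trans ?_
    rw [mem_ball_iff_norm] at hζ
    calc 5 / r * ‖ζ - w‖ ≤ 5 / r * (r / 20) := by gcongr
      _ = 1 / 4 := by field_simp; norm_num
  have hTlow : 1 / 4 ≤ ‖T ζ‖ := by
    have h1 : ‖T w‖ ≤ ‖T ζ‖ + ‖T ζ - T w‖ := by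
      have := _root_.norm_sub_le (T ζ) (T ζ - T w)
      rwa [sub_sub_cancel] at this
    rw [hTw] at h1 hTclose
    norm_num at h1
    linarith
  have hsζ : ‖s ζ‖ ≤ 5 := by
    have hz := h1s ζ (hsub20 hζ)
    have h1 : ‖1 + s ζ‖ ≤ 4 := by
      rw [hT] at hTlow
      simp only [norm_inv] at hTlow
      have h2 : 0 < ‖1 + s ζ‖ := norm_pos_iff.2 hz
      rw [le_inv_comm₀ (by norm_num) h2] at hTlow
      linarith
    have h2 := _root_.norm_sub_le (1 + s ζ) 1
    rw [add_sub_cancel_left, norm_one] at h2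
    linarith
  have hfin : φ ζ - φ w = (a - φ w) * (1 - s ζ ^ 2) := by
    have := hsq ζ (hsub20 hζ)
    rw [eq_div_iff hne] at this
    linear_combination this
  rw [hfin, norm_mul, mul_comm]
  refine mul_le_mul_of_nonneg_right ?_ hd.le
  calc ‖1 - s ζ ^ 2‖ ≤ ‖(1 : ℂ)‖ + ‖s ζ ^ 2‖ := _root_.norm_sub_le _ _
    _ = 1 + ‖s ζ‖ ^ 2 := by simp
    _ ≤ 26 := by nlinarith [norm_nonneg (s ζ)]

/-- A weak form of the Koebe one quarter theorem, together with the estimate coming from the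
omitted value `0`. -/
theorem exists_radius (h : IsBranchOmittingZero f φ w r) :
    ∃ d, 0 < d ∧ Metric.ball (φ w) d ⊆ φ '' Metric.ball w r ∧ d ≤ ‖φ w‖ ∧ d ≤ r * ‖deriv φ w‖ ∧
      ∀ ζ ∈ Metric.ball w (r / 40), ‖deriv φ ζ‖ * r ≤ 1040 * d := by
  obtain ⟨a, ha, hd, hsub, hle⟩ := h.exists_nearest_omitted
  have hr := h.pos
  refine ⟨_, hd, hsub, hle, h.radius_le hd hsub, fun ζ hζ => ?_⟩
  have hball : Metric.ball ζ (r / 40) ⊆ Metric.ball w (r / 20) := by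
    refine Metric.ball_subset_ball' ?_
    rw [Metric.mem_ball] at hζ
    linarith
  have hcl : Metric.closedBall ζ (r / 40) ⊆ Metric.ball w (r / 20) := by
    refine Metric.closedBall_subset_ball' ?_
    rw [Metric.mem_ball] at hζ
    linarith
  have hsub20 : Metric.ball w (r / 20) ⊆ Metric.ball w r := Metric.ball_subset_ball (by linarith)
  have hr40 : 0 < r / 40 := by linarith
  -- Cauchy's estimate on a circle of radius `r/40`; hence `1040 = 26·40`.
  have h1 := Complex.norm_deriv_le_of_forall_mem_sphere_norm_le (f := fun z => φ z - φ w) (c := ζ)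
    (C := 26 * ‖a - φ w‖) hr40
    ((h.differentiableOn.sub_const (φ w)).mono
      (closure_ball ζ hr40.ne' ▸ hcl.trans hsub20)).diffContOnCl
    (fun z hz => h.norm_sub_le ha hd hsub (hcl (Metric.sphere_subset_closedBall hz)))
  rw [deriv_sub_const, le_div_iff₀ hr40] at h1
  linarith

theorem norm_deriv_le (h : IsBranchOmittingZero f φ w r) {ζ : ℂ}
    (hζ : ζ ∈ Metric.ball w (r / 40)) : ‖deriv φ ζ‖ ≤ 1040 * ‖deriv φ w‖ := by
  obtain ⟨d, -, -, -, h1, h2⟩ := h.exists_radius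
  have := h2 ζ hζ
  have hr := h.pos
  refine le_of_mul_le_mul_right ?_ hr
  linarith

/-- The previous bound with the roles of `w` and `ζ` exchanged, on the disk of radius `r/2` around
`ζ`; `r/80` is a fortieth of that radius. -/
theorem norm_deriv_center_le (h : IsBranchOmittingZero f φ w r) {ζ : ℂ}
    (hζ : ζ ∈ Metric.ball w (r / 80)) : ‖deriv φ w‖ ≤ 1040 * ‖deriv φ ζ‖ := by
  have hr := h.pos
  rw [Metric.mem_ball] at hζ
  refine (h.mono (w' := ζ) (r' := r / 2) (by linarith)
    (Metric.ball_subset_ball' (by linarith))).norm_deriv_le ?_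
  rw [Metric.mem_ball, dist_comm]
  linarith

/-- The omitted value `0` enters here: the nearest omitted value is no farther from `φ w` than `0`
is. -/
theorem norm_deriv_mul_le (h : IsBranchOmittingZero f φ w r) :
    ‖deriv φ w‖ * r ≤ 1040 * ‖φ w‖ := by
  obtain ⟨d, -, -, h1, -, h2⟩ := h.exists_radius
  have hr := h.pos
  have := h2 w (Metric.mem_ball_self (by linarith))
  linarith

theorem ball_subset_image (h : IsBranchOmittingZero f φ w r) :
    Metric.ball (φ w) (‖deriv φ w‖ * r / 1040) ⊆ φ '' Metric.ball w r := by
  obtain ⟨d, -, hsub, -, -, h2⟩ := h.exists_radius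
  have hr := h.pos
  have := h2 w (Metric.mem_ball_self (by linarith))
  exact (Metric.ball_subset_ball (by linarith)).trans hsub

end IsBranchOmittingZero

/-! ### Cylindrical area of preimages of nearby disks. -/

/-- The cylindrical measure as a Borel measure on the plane. -/
noncomputable def cylMeasure : Measure ℂ :=
  ENNReal.ofReal (1 / (2 * Real.pi)) • volume.withDensity fun z => ENNReal.ofReal (1 / ‖z‖ ^ 2)

theorem cylMeasure_apply (A : Set ℂ) : cylMeasure A = cylindricalMeasure A := by
  rw [cylMeasure, Measure.smul_apply, withDensity_apply', smul_eq_mul, cylindricalMeasure]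

theorem cylMeasure_le {A : Set ℂ} {m : ℝ} (hm : 0 < m) (hA : ∀ z ∈ A, m ≤ ‖z‖) :
    cylMeasure A ≤
      ENNReal.ofReal (1 / (2 * Real.pi)) * (ENNReal.ofReal (1 / m ^ 2) * volume A) := by
  rw [cylMeasure_apply, cylindricalMeasure]
  gcongr
  rw [← setLIntegral_const]
  refine setLIntegral_mono measurable_const fun z hz => ENNReal.ofReal_le_ofReal ?_
  have := hA z hz
  gcongr

theorem le_cylMeasure {A : Set ℂ} (hAm : MeasurableSet A) {m M : ℝ} (hm : 0 < m)
    (hA : ∀ z ∈ A, m ≤ ‖z‖ ∧ ‖z‖ ≤ M) :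
    ENNReal.ofReal (1 / (2 * Real.pi)) * (ENNReal.ofReal (1 / M ^ 2) * volume A) ≤
      cylMeasure A := by
  rw [cylMeasure_apply, cylindricalMeasure]
  gcongr
  rw [← setLIntegral_const]
  refine setLIntegral_mono' hAm fun z hz => ENNReal.ofReal_le_ofReal ?_
  obtain ⟨h1, h2⟩ := hA z hz
  have : 0 < ‖z‖ := hm.trans_le h1
  gcongr

/-- The part of the preimage of `A` outside the disk of radius `ρ` around `0`. -/
def farPreimage (f : ℂ → ℂ) (ρ : ℝ) (A : Set ℂ) : Set ℂ := {z | ρ ≤ ‖z‖} ∩ f ⁻¹' A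

namespace IsBranchOmittingZero

variable {f φ : ℂ → ℂ} {w : ℂ} {r : ℝ}

/-- The constants satisfy `1040/5000000 ≤ 1/4800` and `1040/4800 < 1/4`; the latter keeps `|φ|`
within a quarter of `|φ w|`. -/
theorem norm_sub_le_deriv (h : IsBranchOmittingZero f φ w r) {ζ : ℂ}
    (hζ : ζ ∈ Metric.ball w (r / 5000000)) : ‖φ ζ - φ w‖ ≤ ‖deriv φ w‖ * r / 4800 := by
  have hr := h.pos
  have h1 := (convex_ball w (r / 5000000)).norm_image_sub_le_of_norm_deriv_le (f := φ)
    (C := 1040 * ‖deriv φ w‖)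
    (fun x hx => h.differentiableOn.differentiableAt (Metric.isOpen_ball.mem_nhds
      (Metric.ball_subset_ball (by linarith) hx)))
    (fun x hx => h.norm_deriv_le (Metric.ball_subset_ball (by linarith) hx))
    (Metric.mem_ball_self (by positivity)) hζ
  rw [mem_ball_iff_norm] at hζ
  calc ‖φ ζ - φ w‖ ≤ 1040 * ‖deriv φ w‖ * ‖ζ - w‖ := h1
    _ ≤ 1040 * ‖deriv φ w‖ * (r / 5000000) := by gcongr
    _ ≤ ‖deriv φ w‖ * r / 4800 := by
      have := mul_nonneg (norm_nonneg (deriv φ w)) hr.le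
      linarith

theorem norm_mem_Icc (h : IsBranchOmittingZero f φ w r) {ζ : ℂ}
    (hζ : ζ ∈ Metric.ball w (r / 5000000)) :
    3 / 4 * ‖φ w‖ ≤ ‖φ ζ‖ ∧ ‖φ ζ‖ ≤ 5 / 4 * ‖φ w‖ := by
  have h1 := h.norm_sub_le_deriv hζ
  have h2 := h.norm_deriv_mul_le
  have h3 := abs_le.1 ((abs_norm_sub_norm_le (φ ζ) (φ w)).trans h1)
  have := norm_nonneg (φ w)
  constructor <;> linarith [h3.1, h3.2]

/-- The cylindrical area of the image of a small disk is controlled by that of a disk inside the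
image of any smaller disk in it. -/
theorem cylMeasure_image_le (h : IsBranchOmittingZero f φ w r) {w' : ℂ} {r' : ℝ} (hr' : 0 < r')
    (hsub : Metric.ball w' r' ⊆ Metric.ball w (r / 5000000)) :
    cylMeasure (φ '' Metric.ball w (r / 5000000)) ≤
      ENNReal.ofReal (25 / 9 * (1040 * 1040 * r / r') ^ 2) *
        cylMeasure (Metric.ball (φ w') (‖deriv φ w'‖ * r' / 1040)) := by
  have hr := h.pos
  have hw : w ∈ Metric.ball w r := Metric.mem_ball_self hr
  have hw' : w' ∈ Metric.ball w (r / 5000000) := hsub (Metric.mem_ball_self hr')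
  have hN : 0 < ‖φ w‖ := norm_pos_iff.2 (h.ne_zero w hw)
  have hD : 0 < ‖deriv φ w‖ := norm_pos_iff.2 (right_ne_zero_of_mul_eq_one (h.deriv_mul_deriv hw))
  have hDD : ‖deriv φ w‖ ≤ 1040 * ‖deriv φ w'‖ :=
    h.norm_deriv_center_le (Metric.ball_subset_ball (by linarith) hw')
  have himg : Metric.ball (φ w') (‖deriv φ w'‖ * r' / 1040) ⊆ φ '' Metric.ball w' r' :=
    (h.mono hr' (hsub.trans (Metric.ball_subset_ball (by linarith)))).ball_subset_image
  have hup := cylMeasure_le (A := φ '' Metric.ball w (r / 5000000)) (m := 3 / 4 * ‖φ w‖)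
    (by positivity) (by
      rintro _ ⟨ζ, hζ, rfl⟩
      exact (h.norm_mem_Icc hζ).1)
  have hlow := le_cylMeasure (A := Metric.ball (φ w') (‖deriv φ w'‖ * r' / 1040))
    Metric.isOpen_ball.measurableSet (m := 3 / 4 * ‖φ w‖) (M := 5 / 4 * ‖φ w‖) (by positivity) (by
      intro z hz
      obtain ⟨ζ, hζ, rfl⟩ := himg hz
      exact h.norm_mem_Icc (hsub hζ))
  have hvol : volume (φ '' Metric.ball w (r / 5000000)) ≤
      volume (Metric.ball (φ w) (‖deriv φ w‖ * r)) := by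
    refine measure_mono ?_
    rintro _ ⟨ζ, hζ, rfl⟩
    rw [mem_ball_iff_norm]
    refine (h.norm_sub_le_deriv hζ).trans_lt ?_
    have := mul_pos hD hr
    linarith
  rw [Complex.volume_ball] at hvol hlow
  refine hup.trans (le_trans ?_ (mul_le_mul' le_rfl hlow))
  rw [mul_left_comm (ENNReal.ofReal (25 / 9 * _))]
  refine mul_le_mul' le_rfl ?_
  refine (mul_le_mul' le_rfl hvol).trans ?_
  rw [← mul_assoc, ← mul_assoc, ← mul_assoc]
  refine mul_le_mul' ?_ le_rfl
  rw [← ENNReal.ofReal_pow (by positivity), ← ENNReal.ofReal_pow (by positivity),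
    ← ENNReal.ofReal_mul (by positivity), ← ENNReal.ofReal_mul (by positivity),
    ← ENNReal.ofReal_mul (by positivity)]
  refine ENNReal.ofReal_le_ofReal ?_
  -- The factor `25/9` is the squared ratio of `5/4` to `3/4` from the density. One `1040` is the
  -- distortion between `w` and `w'`, the other the loss in the radius of the inner disk.
  have e1 : 25 / 9 * (1040 * 1040 * r / r') ^ 2 * (1 / (5 / 4 * ‖φ w‖) ^ 2) *
      (‖deriv φ w'‖ * r' / 1040) ^ 2 =
      1 / (3 / 4 * ‖φ w‖) ^ 2 * (1040 * ‖deriv φ w'‖ * r) ^ 2 := by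
    field_simp
    ring
  rw [e1]
  gcongr

end IsBranchOmittingZero

/-- Comparison of the cylindrical areas of the far preimages of nearby small disks. -/
theorem exists_cylMeasure_farPreimage_ball_le {f : ℂ → ℂ} (hf : Differentiable ℂ f) {w : ℂ} {r : ℝ}
    (hr : 0 < r) (hB : ∀ ζ ∈ Metric.ball w r, ζ ∉ SV f) {w' : ℂ}
    (hw' : w' ∈ Metric.ball w (r / 5000000)) {N : Set ℂ} (hN : N ∈ 𝓝 w') :
    ∃ C : ℝ≥0∞, C ≠ ⊤ ∧ ∀ᶠ ρ : ℝ in atTop,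
      cylMeasure (farPreimage f ρ (Metric.ball w (r / 5000000))) ≤
        C * cylMeasure (farPreimage f (1 / 2 * ρ) N) := by
  set Δ := Metric.ball w (r / 5000000) with hΔ
  have hww : w ∈ Metric.ball w r := Metric.mem_ball_self hr
  have hΔr : Δ ⊆ Metric.ball w r := Metric.ball_subset_ball (by linarith)
  obtain ⟨r', hr', hsub⟩ :=
    Metric.mem_nhds_iff.1 (inter_mem hN (Metric.isOpen_ball.mem_nhds hw'))
  have hsubN : Metric.ball w' r' ⊆ N := hsub.trans inter_subset_left
  have hsubΔ : Metric.ball w' r' ⊆ Δ := hsub.trans inter_subset_right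
  have hbr : ∀ z, f z = w → ∃ φ : ℂ → ℂ, DifferentiableOn ℂ φ (Metric.ball w r) ∧
      (∀ ζ ∈ Metric.ball w r, f (φ ζ) = ζ) ∧ φ w = z := fun z hz => by
    obtain ⟨φ, h1, h2, h3⟩ := exists_branch hf hB (z₀ := z) (hz ▸ hww)
    exact ⟨φ, h1, h2, hz ▸ h3⟩
  choose! φ hφd hφf hφw using hbr
  -- at most one branch takes the value `0`, and it is bounded on `Δ`
  obtain ⟨ρ₀, hρ₀⟩ : ∃ ρ₀ : ℝ, ∀ z, f z = w → (∃ ζ ∈ Metric.ball w r, φ z ζ = 0) →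
      ∀ ζ ∈ Δ, ‖φ z ζ‖ ≤ ρ₀ := by
    by_cases hex : ∃ z, f z = w ∧ ∃ ζ ∈ Metric.ball w r, φ z ζ = 0
    · obtain ⟨z₁, hz₁, ξ, hξ, hξ0⟩ := hex
      have hcl : Metric.closedBall w (r / 5000000) ⊆ Metric.ball w r :=
        Metric.closedBall_subset_ball (by linarith)
      obtain ⟨ρ₀, hρ₀⟩ := (isCompact_closedBall w (r / 5000000)).exists_bound_of_continuousOn
        ((hφd z₁ hz₁).continuousOn.mono hcl)
      refine ⟨ρ₀, ?_⟩
      rintro z hz ⟨ζ, hζ, hζ0⟩ x hx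
      rw [branch_eqOn hf hB (hφd z hz) (hφd z₁ hz₁) (hφf z hz) (hφf z₁ hz₁) hζ hξ
        (hζ0.trans hξ0.symm) (hΔr hx)]
      exact hρ₀ x (Metric.ball_subset_closedBall hx)
    · push Not at hex
      exact ⟨0, fun z hz ⟨ζ, hζ, h0⟩ => absurd h0 (hex z hz ζ hζ)⟩
  refine ⟨ENNReal.ofReal (25 / 9 * (1040 * 1040 * r / r') ^ 2), ENNReal.ofReal_ne_top, ?_⟩
  filter_upwards [eventually_gt_atTop ρ₀, eventually_gt_atTop 0] with ρ hρ hρ0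
  -- Branches are indexed by their value at the center; `I` keeps those that reach `|z| ≥ ρ` over
  -- `Δ`. As `ρ > ρ₀`, they all omit `0`.
  set I : Set ℂ := {z | f z = w ∧ ∃ ζ ∈ Δ, ρ ≤ ‖φ z ζ‖} with hI
  have hIb : ∀ z ∈ I, IsBranchOmittingZero f (φ z) w r := by
    rintro z ⟨hz, ζ, hζ, hle⟩
    refine ⟨hf, hr, hφd z hz, hφf z hz, fun x hx h0 => ?_⟩
    have := hρ₀ z hz ⟨x, hx, h0⟩ ζ hζ
    linarith
  have hcover : farPreimage f ρ Δ ⊆ ⋃ z ∈ I, φ z '' Δ := by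
    rintro x ⟨hx, hfx⟩
    obtain ⟨ψ, h1, h2, h3⟩ := exists_branch hf hB (hΔr hfx)
    have hz : f (ψ w) = w := h2 w hww
    have heq := branch_eqOn hf hB (hφd _ hz) h1 (hφf _ hz) h2 hww hww (hφw _ hz)
    have hx' : φ (ψ w) (f x) = x := by rw [heq (hΔr hfx), h3]
    exact mem_iUnion₂.2 ⟨ψ w, ⟨hz, f x, hfx, by rw [hx']; exact hx⟩, f x, hfx, hx'⟩
  set b : ℂ → Set ℂ := fun z => Metric.ball (φ z w') (‖deriv (φ z) w'‖ * r' / 1040) with hb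
  have hbimg : ∀ z ∈ I, b z ⊆ φ z '' Metric.ball w' r' := fun z hz =>
    ((hIb z hz).mono hr' (hsubΔ.trans hΔr)).ball_subset_image
  -- Reaching modulus `ρ` somewhere over `Δ` forces modulus at least `(3/4)/(5/4)·ρ = 3ρ/5`
  -- everywhere over `Δ`.
  have hbfar : ∀ z ∈ I, b z ⊆ farPreimage f (1 / 2 * ρ) N := by
    intro z hz x hx
    obtain ⟨ξ, hξ, rfl⟩ := hbimg z hz hx
    obtain ⟨ζ, hζ, hle⟩ := hz.2
    have h1 := (hIb z hz).norm_mem_Icc hζ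
    have h2 := (hIb z hz).norm_mem_Icc (hsubΔ hξ)
    refine ⟨?_, ?_⟩
    · change 1 / 2 * ρ ≤ ‖φ z ξ‖
      linarith [h1.2, h2.1]
    · change f (φ z ξ) ∈ N
      rw [hφf z hz.1 ξ (hΔr (hsubΔ hξ))]
      exact hsubN hξ
  have hdisj : I.PairwiseDisjoint b := by
    intro z hz z' hz' hne
    refine Set.disjoint_left.2 fun x hx hx' => hne ?_
    obtain ⟨ξ, hξ, h1⟩ := hbimg z hz hx
    obtain ⟨ξ', hξ', h2⟩ := hbimg z' hz' hx'
    have := branch_eqOn hf hB (hφd z hz.1) (hφd z' hz'.1) (hφf z hz.1) (hφf z' hz'.1)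
      (hΔr (hsubΔ hξ)) (hΔr (hsubΔ hξ')) (h1.trans h2.symm) hww
    rwa [hφw z hz.1, hφw z' hz'.1] at this
  have hcount : I.Countable := by
    refine hdisj.countable_of_isOpen (fun z _ => Metric.isOpen_ball) fun z hz => ?_
    have h0 : deriv (φ z) w' ≠ 0 :=
      right_ne_zero_of_mul_eq_one ((hIb z hz).deriv_mul_deriv (hΔr hw'))
    have := norm_pos_iff.2 h0
    exact ⟨φ z w', Metric.mem_ball_self (by positivity)⟩
  calc cylMeasure (farPreimage f ρ Δ) ≤ cylMeasure (⋃ z ∈ I, φ z '' Δ) := measure_mono hcover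
    _ ≤ ∑' z : I, cylMeasure (φ z '' Δ) := measure_biUnion_le _ hcount _
    _ ≤ ∑' z : I, ENNReal.ofReal (25 / 9 * (1040 * 1040 * r / r') ^ 2) * cylMeasure (b z) :=
      ENNReal.tsum_le_tsum fun z => (hIb z z.2).cylMeasure_image_le hr' hsubΔ
    _ = ENNReal.ofReal (25 / 9 * (1040 * 1040 * r / r') ^ 2) * cylMeasure (⋃ z ∈ I, b z) := by
      rw [ENNReal.tsum_mul_left,
        measure_biUnion hcount hdisj fun z _ => Metric.isOpen_ball.measurableSet]
    _ ≤ _ := by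
      gcongr
      exact iUnion₂_subset hbfar

/-! ### Chaining comparisons through the nonsingular values. -/

/-- The cylindrical area of the far preimages of `A` is controlled by that of `N`. -/
def FarDominated (f : ℂ → ℂ) (A N : Set ℂ) : Prop :=
  ∃ C : ℝ≥0∞, C ≠ ⊤ ∧ ∃ α : ℝ, 0 < α ∧ α < 1 ∧ ∀ᶠ ρ : ℝ in atTop,
    cylMeasure (farPreimage f ρ A) ≤ C * cylMeasure (farPreimage f (α * ρ) N)

theorem farPreimage_mono {f : ℂ → ℂ} {ρ ρ' : ℝ} {A B : Set ℂ} (hρ : ρ' ≤ ρ) (hAB : A ⊆ B) :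
    farPreimage f ρ A ⊆ farPreimage f ρ' B :=
  fun _ hz => ⟨hρ.trans hz.1, hAB hz.2⟩

theorem areaIntegral_eq (f : ℂ → ℂ) (α ρ : ℝ) (D : Set ℂ) :
    areaIntegral f α ρ D = cylMeasure (farPreimage f (α * ρ) (Metric.closedBall 0 ρ \ D)) := by
  rw [cylMeasure_apply]
  rfl

theorem FarDominated.empty (f : ℂ → ℂ) (N : Set ℂ) : FarDominated f ∅ N :=
  ⟨0, ENNReal.zero_ne_top, 1 / 2, by norm_num, by norm_num, by simp [farPreimage]⟩

theorem FarDominated.mono {f : ℂ → ℂ} {A B N : Set ℂ} (hAB : A ⊆ B) (h : FarDominated f B N) :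
    FarDominated f A N := by
  obtain ⟨C, hC, α, h0, h1, h⟩ := h
  refine ⟨C, hC, α, h0, h1, ?_⟩
  filter_upwards [h] with ρ hρ
  exact (measure_mono (farPreimage_mono le_rfl hAB)).trans hρ

theorem FarDominated.union {f : ℂ → ℂ} {A B N : Set ℂ} (hA : FarDominated f A N)
    (hB : FarDominated f B N) : FarDominated f (A ∪ B) N := by
  obtain ⟨C, hC, α, hα0, hα1, hA⟩ := hA
  obtain ⟨C', hC', α', hα0', hα1', hB⟩ := hB
  refine ⟨C + C', ENNReal.add_ne_top.2 ⟨hC, hC'⟩, min α α', lt_min hα0 hα0',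
    (min_le_left _ _).trans_lt hα1, ?_⟩
  filter_upwards [hA, hB, eventually_ge_atTop 0] with ρ h1 h2 hρ
  have hsplit : farPreimage f ρ (A ∪ B) ⊆ farPreimage f ρ A ∪ farPreimage f ρ B := by
    rintro z ⟨hz, hz' | hz'⟩
    exacts [Or.inl ⟨hz, hz'⟩, Or.inr ⟨hz, hz'⟩]
  have m1 : farPreimage f (α * ρ) N ⊆ farPreimage f (min α α' * ρ) N :=
    farPreimage_mono (by gcongr; exact min_le_left _ _) le_rfl
  have m2 : farPreimage f (α' * ρ) N ⊆ farPreimage f (min α α' * ρ) N :=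
    farPreimage_mono (by gcongr; exact min_le_right _ _) le_rfl
  calc cylMeasure (farPreimage f ρ (A ∪ B))
      ≤ cylMeasure (farPreimage f ρ A) + cylMeasure (farPreimage f ρ B) :=
        (measure_mono hsplit).trans (measure_union_le _ _)
    _ ≤ C * cylMeasure (farPreimage f (α * ρ) N) + C' * cylMeasure (farPreimage f (α' * ρ) N) :=
        add_le_add h1 h2
    _ ≤ _ := by
        rw [add_mul]
        gcongr

theorem FarDominated.trans {f : ℂ → ℂ} {A B N : Set ℂ} (hAB : FarDominated f A B)
    (hBN : FarDominated f B N) : FarDominated f A N := by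
  obtain ⟨C, hC, α, hα0, hα1, hA⟩ := hAB
  obtain ⟨C', hC', α', hα0', hα1', hB⟩ := hBN
  refine ⟨C * C', ENNReal.mul_ne_top hC hC', α' * α, mul_pos hα0' hα0,
    mul_lt_one_of_nonneg_of_lt_one_left hα0'.le hα1' hα1.le, ?_⟩
  filter_upwards [hA, (tendsto_id.const_mul_atTop hα0).eventually hB] with ρ h1 h2
  rw [mul_assoc, mul_assoc]
  exact h1.trans (mul_le_mul' le_rfl h2)

/-- Every nonsingular value has a neighborhood whose far preimages are controlled by those of a
given neighborhood of a given nonsingular value. -/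
theorem exists_farDominated {f : ℂ → ℂ} (hf : IsFiniteType f) {w₀ : ℂ} (hw₀ : w₀ ∉ SV f) {N : Set ℂ}
    (hN : N ∈ 𝓝 w₀) {w : ℂ} (hw : w ∉ SV f) : ∃ A ∈ 𝓝 w, FarDominated f A N := by
  have hloc : ∀ x, x ∉ SV f → ∃ Δ : Set ℂ, IsOpen Δ ∧ x ∈ Δ ∧ ∀ y ∈ Δ, ∀ B ∈ 𝓝 y,
      FarDominated f Δ B := by
    intro x hx
    obtain ⟨r, hr, hB⟩ := Metric.isOpen_iff.1 (isClosed_closure (s := _)).isOpen_compl x hx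
    refine ⟨Metric.ball x (r / 5000000), Metric.isOpen_ball,
      Metric.mem_ball_self (by positivity), fun y hy B hBy => ?_⟩
    obtain ⟨C, hC, h⟩ := exists_cylMeasure_farPreimage_ball_le hf.1.1 hr (fun ζ hζ => hB hζ) hy hBy
    exact ⟨C, hC, 1 / 2, by norm_num, by norm_num, h⟩
  have hconn : IsPreconnected (SV f)ᶜ :=
    (hf.2.countable.isConnected_compl_of_one_lt_rank
      (by rw [Complex.rank_real_complex]; norm_num)).isPreconnected
  have hopen : IsOpen {x | ∃ A ∈ 𝓝 x, FarDominated f A N} := by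
    rw [isOpen_iff_mem_nhds]
    rintro x ⟨A, hA, hAN⟩
    filter_upwards [eventually_mem_nhds_iff.2 hA] with y hy using ⟨A, hy, hAN⟩
  -- The set of good points is relatively closed: the disk `Δ` around a limit point contains a good
  -- point `y`, and `Δ` is dominated by any neighborhood of `y`.
  refine hconn.subset_of_closure_inter_subset hopen ⟨w₀, hw₀, ?_⟩ ?_ hw
  · obtain ⟨Δ, hΔ, hwΔ, h⟩ := hloc w₀ hw₀
    exact ⟨Δ, hΔ.mem_nhds hwΔ, h w₀ hwΔ N hN⟩
  · rintro x ⟨hxcl, hx⟩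
    obtain ⟨Δ, hΔ, hxΔ, h⟩ := hloc x hx
    obtain ⟨y, hyΔ, A, hA, hAN⟩ := mem_closure_iff.1 hxcl Δ hΔ hxΔ
    exact ⟨Δ, hΔ.mem_nhds hxΔ, (h y hyΔ A hA).trans hAN⟩

theorem farDominated_of_isCompact {f : ℂ → ℂ} (hf : IsFiniteType f) {w₀ : ℂ} (hw₀ : w₀ ∉ SV f)
    {N : Set ℂ} (hN : N ∈ 𝓝 w₀) {K : Set ℂ} (hK : IsCompact K) (hKSV : ∀ w ∈ K, w ∉ SV f) :
    FarDominated f K N := by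
  refine hK.induction_on (FarDominated.empty f N) (fun _ _ hst ht => ht.mono hst)
    (fun _ _ hs ht => hs.union ht) fun w hw => ?_
  obtain ⟨A, hA, h⟩ := exists_farDominated hf hw₀ hN (hKSV w hw)
  exact ⟨A, mem_nhdsWithin_of_mem_nhds hA, h⟩

/-- Density of values near infinity puts a disk inside the set. Positivity makes the final
inequality strict. -/
theorem cylMeasure_farPreimage_pos {f : ℂ → ℂ} (hf : IsTranscendentalEntire f) {w₀ : ℂ} {N : Set ℂ}
    (hN : N ∈ 𝓝 w₀) {ρ : ℝ} (hρ : 0 < ρ) : 0 < cylMeasure (farPreimage f ρ N) := by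
  obtain ⟨ε, hε, hball⟩ := Metric.mem_nhds_iff.1 hN
  obtain ⟨z, hz, hfz⟩ := hf.exists_norm_gt_dist_lt w₀ hε ρ
  have hopen : IsOpen ({z : ℂ | ρ < ‖z‖} ∩ f ⁻¹' Metric.ball w₀ ε) :=
    (isOpen_lt continuous_const continuous_norm).inter
      (Metric.isOpen_ball.preimage hf.1.continuous)
  obtain ⟨δ, hδ, hsub⟩ := Metric.isOpen_iff.1 hopen z ⟨hz, hfz⟩
  have hle := le_cylMeasure (A := Metric.ball z δ) Metric.isOpen_ball.measurableSet (m := ρ)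
    (M := ‖z‖ + δ) hρ fun x hx => by
      refine ⟨(hsub hx).1.le, ?_⟩
      have h1 := norm_sub_norm_le x z
      rw [mem_ball_iff_norm] at hx
      linarith
  refine lt_of_lt_of_le ?_ (hle.trans (measure_mono fun x hx =>
    ⟨le_of_lt (show ρ < ‖x‖ from (hsub hx).1), hball (hsub hx).2⟩))
  refine ENNReal.mul_pos ?_ (ENNReal.mul_pos ?_ (Metric.measure_ball_pos _ _ hδ).ne').ne'
  · rw [Ne, ENNReal.ofReal_eq_zero, not_le]
    positivity
  · rw [Ne, ENNReal.ofReal_eq_zero, not_le]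
    positivity

end EntireAAP

/-! ### The proposition. -/

theorem mainTheorem10 (f : ℂ → ℂ) (hf : EntireAAP.IsFiniteType f)
    (hdeg : EntireAAP.HasBoundedCriticalDegrees f)
    (Dv : ℂ → Set ℂ) (D : Set ℂ)
    (hDv : ∀ v ∈ EntireAAP.SV f, EntireAAP.IsBoundedRiemannDomain (Dv v) ∧ v ∈ Dv v)
    (hdisj : (EntireAAP.SV f).PairwiseDisjoint (fun v => closure (Dv v)))
    (hD : D = ⋃ v ∈ EntireAAP.SV f, Dv v)
    (hAAP : EntireAAP.HasAAPRelativeTo f D)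
    (D' : Set ℂ) (hD'open : IsOpen D') (hD'sub : D' ⊆ D) (hD'SV : EntireAAP.SV f ⊆ D') :
    EntireAAP.HasAAPRelativeTo f D' ∧
      ∃ M : ℝ, 1 < M ∧ ∃ α : ℝ, 0 < α ∧ α < 1 ∧
        ∀ᶠ ρ : ℝ in atTop,
          EntireAAP.areaIntegral f 1 ρ D' <
            ENNReal.ofReal M * EntireAAP.areaIntegral f α ρ D := by
  have hDb : Bornology.IsBounded D := by
    rw [hD]
    exact (Bornology.isBounded_biUnion hf.2).2 fun v hv => (hDv v hv).1.2.2
  obtain ⟨R, hR0, hR⟩ := hDb.subset_ball_lt 0 0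
  set w₀ : ℂ := ((R + 1 : ℝ) : ℂ) with hw₀
  have hw₀n : ‖w₀‖ = R + 1 := by
    rw [hw₀, Complex.norm_real, Real.norm_of_nonneg (by linarith)]
  set N : Set ℂ := Metric.ball w₀ 1 with hNdef
  have hN : N ∈ 𝓝 w₀ := Metric.ball_mem_nhds _ one_pos
  have hNnorm : ∀ z ∈ N, R < ‖z‖ ∧ ‖z‖ < R + 2 := by
    intro z hz
    rw [hNdef, mem_ball_iff_norm] at hz
    have := abs_lt.1 ((abs_norm_sub_norm_le z w₀).trans_lt hz)
    constructor <;> linarith [this.1, this.2]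
  have hND : ∀ z ∈ N, z ∉ D := fun z hz hzD => by
    have := hR hzD
    rw [mem_ball_zero_iff] at this
    linarith [(hNnorm z hz).1]
  have hw₀SV : w₀ ∉ EntireAAP.SV f := fun h =>
    hND w₀ (Metric.mem_ball_self one_pos) (hD'sub (hD'SV h))
  have hK : IsCompact (closure D \ D') := hDb.isCompact_closure.diff hD'open
  obtain ⟨C, hC, α, hα0, hα1, hdom⟩ := EntireAAP.farDominated_of_isCompact hf hw₀SV hN hK
    fun w hw h => hw.2 (hD'SV h)
  have hNsub : ∀ᶠ ρ : ℝ in atTop, N ⊆ Metric.closedBall 0 ρ \ D := by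
    filter_upwards [eventually_ge_atTop (R + 2)] with ρ hρ z hz
    exact ⟨mem_closedBall_zero_iff.2 ((hNnorm z hz).2.le.trans hρ), hND z hz⟩
  have hmain : ∀ᶠ ρ : ℝ in atTop, EntireAAP.areaIntegral f 1 ρ D' ≤
      EntireAAP.areaIntegral f 1 ρ D +
        C * EntireAAP.cylMeasure (EntireAAP.farPreimage f (α * ρ) N) := by
    filter_upwards [hdom] with ρ hρ
    rw [EntireAAP.areaIntegral_eq, EntireAAP.areaIntegral_eq, one_mul]
    refine (measure_mono ?_).trans ((measure_union_le _ _).trans (add_le_add le_rfl hρ))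
    rintro z ⟨hz, hz', hzD'⟩
    by_cases hzD : f z ∈ D
    · exact Or.inr ⟨hz, subset_closure hzD, hzD'⟩
    · exact Or.inl ⟨hz, hz', hzD⟩
  obtain ⟨B, hB, hBtop⟩ := exists_between hAAP
  have hbound : ∀ᶠ ρ : ℝ in atTop, EntireAAP.areaIntegral f 1 ρ D < B :=
    eventually_lt_of_limsup_lt hB
  have hscale : Tendsto (fun ρ : ℝ => α * ρ) atTop atTop := tendsto_id.const_mul_atTop hα0
  -- AAP is used at the two scales `ρ` and `αρ`: at the second, `N` already lies in the disk of
  -- radius `αρ`.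
  have hbound' : ∀ᶠ ρ : ℝ in atTop, EntireAAP.areaIntegral f 1 ρ D' ≤ B + C * B := by
    filter_upwards [hmain, hbound, hscale.eventually hbound, hscale.eventually hNsub]
      with ρ h1 h2 h3 h4
    refine h1.trans (add_le_add h2.le (mul_le_mul' le_rfl (le_trans ?_ h3.le)))
    rw [EntireAAP.areaIntegral_eq, one_mul]
    exact measure_mono (EntireAAP.farPreimage_mono le_rfl h4)
  have hBtop' : B + C * B < ⊤ :=
    ENNReal.add_lt_top.2 ⟨hBtop, ENNReal.mul_lt_top hC.lt_top hBtop⟩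
  refine ⟨(limsup_le_of_le (by isBoundedDefault) hbound').trans_lt hBtop', C.toReal + 2,
    by linarith [C.toReal_nonneg], α, hα0, hα1, ?_⟩
  -- The comparison costs `1 + C`; the extra `1` gives strictness when `I_α(ρ, D)` is finite and
  -- positive. When it is infinite, the bound from the first claim suffices.
  have hM : ENNReal.ofReal (C.toReal + 2) = 1 + C + 1 := by
    rw [ENNReal.ofReal_add ENNReal.toReal_nonneg (by norm_num), ENNReal.ofReal_toReal hC]
    norm_num
    ring
  rw [hM]
  filter_upwards [hmain, hbound', hNsub, eventually_gt_atTop 0] with ρ h1 h2 h3 hρ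
  have hNα : EntireAAP.cylMeasure (EntireAAP.farPreimage f (α * ρ) N) ≤
      EntireAAP.areaIntegral f α ρ D := by
    rw [EntireAAP.areaIntegral_eq]
    exact measure_mono (EntireAAP.farPreimage_mono le_rfl h3)
  have h1α : EntireAAP.areaIntegral f 1 ρ D ≤ EntireAAP.areaIntegral f α ρ D := by
    rw [EntireAAP.areaIntegral_eq, EntireAAP.areaIntegral_eq]
    exact measure_mono (EntireAAP.farPreimage_mono (by gcongr) le_rfl)
  have hpos : 0 < EntireAAP.areaIntegral f α ρ D :=
    (EntireAAP.cylMeasure_farPreimage_pos hf.1 hN (mul_pos hα0 hρ)).trans_le hNα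
  have hle : EntireAAP.areaIntegral f 1 ρ D' ≤ (1 + C) * EntireAAP.areaIntegral f α ρ D := by
    rw [add_mul, one_mul]
    exact h1.trans (add_le_add h1α (mul_le_mul' le_rfl hNα))
  rw [add_mul, one_mul]
  by_cases htop : EntireAAP.areaIntegral f α ρ D = ⊤
  · rw [htop, add_top]
    exact h2.trans_lt hBtop'
  · refine hle.trans_lt (ENNReal.lt_add_right ?_ hpos.ne')
    exact ENNReal.mul_ne_top (ENNReal.add_ne_top.2 ⟨ENNReal.one_ne_top, hC⟩) htop
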